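/- A linear switched system (LSS) of dimension $n$ with modes $\{1,\dots,D\}$, $D\ge 1$, is a family of real matrices $\Sigma=(A_q,B_q,C_q)_{q=1}^{D}$ with $A_q\in\mathbb R^{n\times n}$, $B_q\in\mathbb R^{n\times m}$, $C_q\in\mathbb R^{p\times n}$. It is considered either in continuous time, \[ \dot x(t)=A_{q(t)}x(t)+B_{q(t)}u(t)\ \text{for a.e. } t\ge 0,\qquad y(t)=C_{q(t)}x(t),\qquad x(0)=0, \] with $u\in L_2([0,\infty),\mathbb R^m)$, $q:[0,\infty)\to\{1,\dots,D\}$ piecewise continuous (finitely many discontinuities on each compact interval, one-sided limits exist there), $x$ absolutely continuous on compact intervals and $y$ piecewise continuous; or in discrete time, \[ x(t+1)=A_{q(t)}x(t)+B_{q(t)}u(t),\qquad y(t)=C_{q(t)}x(t),\qquad x(0)=0,\qquad t\in\mathbb N, \] with $u\in l_2(\mathbb N,\mathbb R^m)$ and $q:\mathbb N\to\{1,\dots,D\}$ arbitrary. The input-output map of $\Sigma$ is $(u,q)\mapsto y$. Two LSSs with the same $D,m,p$ are equivalent if they have the same input-output map, and an LSS is minimal if no LSS equivalent to it has smaller dimension.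 A controllability grammian of $\Sigma$ is a symmetric positive definite $\mathcal P$ such that, for all $q$, $A_q\mathcal P+\mathcal PA_q^T+B_qB_q^T\le 0$ (continuous time), respectively $A_q\mathcal PA_q^T+B_qB_q^T-\mathcal P\le 0$ (discrete time). An observability grammian is a symmetric positive definite $\mathcal Q$ such that, for all $q$, $A_q^T\mathcal Q+\mathcal QA_q+C_q^TC_q\le 0$, respectively $A_q^T\mathcal QA_q+C_q^TC_q-\mathcal Q\le 0$. The singular values of a pair $(\mathcal P,\mathcal Q)$ of a controllability and an observability grammian are the eigenvalues of $\mathcal P\mathcal Q$, counted with multiplicity. **Corollary.** In continuous as well as in discrete time, let $\Sigma_1$ and $\Sigma_2$ be minimal and equivalent LSSs. Then for every pair $(\mathcal P_1,\mathcal Q_1)$ of grammians of $\Sigma_1$ there is a pair $(\mathcal P_2,\mathcal Q_2)$ of grammians of $\Sigma_2$ with the same singular values, counted with multiplicity. Consequently, for minimal LSSs the set of all singular value lists of grammian pairs depends only on the input-output map: it is the same for $\Sigma_1$ and $\Sigma_2$. -/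

import Mathlib

open Set Filter Topology MeasureTheory

/-- The two settings treated in parallel: time `[0, ∞)` or time `ℕ`. -/
inductive TimeDomain where
  | continuousTime
  | discreteTime

/-- A linear switched system of dimension `n` with discrete modes `Fin D`, `m` inputs and
`p` outputs. -/
structure LSS (D m p n : ℕ) where
  A : Fin D → Matrix (Fin n) (Fin n) ℝ
  B : Fin D → Matrix (Fin n) (Fin m) ℝ
  C : Fin D → Matrix (Fin p) (Fin n) ℝ

/-! ### Signals

A continuous-time signal is a function on `ℝ` of which only the values on `[0, ∞)` matter. -/

/-- `f` is piecewise continuous on `[0, ∞)`: finitely many discontinuities on each compact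
subinterval, and all one-sided limits exist. -/
def IsPiecewiseContinuous {E : Type*} [TopologicalSpace E] (f : ℝ → E) : Prop :=
  (∀ b : ℝ, {t : ℝ | t ∈ Icc 0 b ∧ ¬ ContinuousWithinAt f (Ici 0) t}.Finite) ∧
  (∀ t : ℝ, 0 ≤ t → ∃ l : E, Tendsto f (𝓝[>] t) (𝓝 l)) ∧
  (∀ t : ℝ, 0 < t → ∃ l : E, Tendsto f (𝓝[<] t) (𝓝 l))

/-- `f` is absolutely continuous on each compact interval `[0, b]`. -/
def IsLocallyAC {k : ℕ} (f : ℝ → Fin k → ℝ) : Prop :=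
  ∀ b : ℝ, 0 ≤ b → AbsolutelyContinuousOnInterval f 0 b

/-- `f` belongs to `L₂([0, ∞), ℝᵏ)`; the integrand is the squared Euclidean norm. -/
def IsL2Signal {k : ℕ} (f : ℝ → Fin k → ℝ) : Prop :=
  AEStronglyMeasurable f (volume.restrict (Ici 0)) ∧
  IntegrableOn (fun t => ∑ i, f t i ^ 2) (Ici 0)

/-- `f` belongs to `l₂(ℕ, ℝᵏ)`. -/
def Isl2Sequence {k : ℕ} (f : ℕ → Fin k → ℝ) : Prop :=
  Summable (fun t => ∑ i, f t i ^ 2)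

namespace LSS

variable {D m p n : ℕ}

/-! ### Solutions and input-output maps -/

/-- `(x, y)` is a continuous-time solution of `S` with initial state `x₀` relative to the control
input `u` and the switching signal `q`. -/
structure IsContSolution (S : LSS D m p n) (x₀ : Fin n → ℝ)
    (u : ℝ → Fin m → ℝ) (q : ℝ → Fin D) (x : ℝ → Fin n → ℝ) (y : ℝ → Fin p → ℝ) : Prop where
  state_ac : IsLocallyAC x
  output_pc : IsPiecewiseContinuous y
  init : x 0 = x₀
  deriv : ∀ᵐ t ∂(volume.restrict (Ici (0 : ℝ))),
    HasDerivAt x ((S.A (q t)).mulVec (x t) + (S.B (q t)).mulVec (u t)) t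
  output : ∀ t : ℝ, 0 ≤ t → y t = (S.C (q t)).mulVec (x t)

/-- `(x, y)` is a discrete-time solution of `S` with initial state `x₀` relative to the control
input `u` and the switching signal `q`. -/
structure IsDiscSolution (S : LSS D m p n) (x₀ : Fin n → ℝ)
    (u : ℕ → Fin m → ℝ) (q : ℕ → Fin D) (x : ℕ → Fin n → ℝ) (y : ℕ → Fin p → ℝ) : Prop where
  init : x 0 = x₀
  step : ∀ t : ℕ, x (t + 1) = (S.A (q t)).mulVec (x t) + (S.B (q t)).mulVec (u t)
  output : ∀ t : ℕ, y t = (S.C (q t)).mulVec (x t)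

/-- The continuous-time input-output map of `S` (initial state zero), given through its graph:
the set of output trajectories belonging to `(u, q)`. For admissible `(u, q)` there is exactly one
such trajectory on `[0, ∞)`. -/
def contIOMap (S : LSS D m p n) (u : ℝ → Fin m → ℝ) (q : ℝ → Fin D) : Set (ℝ → Fin p → ℝ) :=
  {y | ∃ x, S.IsContSolution 0 u q x y}

/-- The discrete-time input-output map of `S` (initial state zero), given through its graph. -/
def discIOMap (S : LSS D m p n) (u : ℕ → Fin m → ℝ) (q : ℕ → Fin D) : Set (ℕ → Fin p → ℝ) :=
  {y | ∃ x, S.IsDiscSolution 0 u q x y}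

/-- Two systems, possibly of different dimensions, are equivalent if their input-output maps
agree on all control inputs in `L₂` (resp. `l₂`) and all switching signals. -/
def Equivalent {n₁ n₂ : ℕ} (τ : TimeDomain) (S₁ : LSS D m p n₁) (S₂ : LSS D m p n₂) : Prop :=
  match τ with
  | .continuousTime => ∀ (u : ℝ → Fin m → ℝ) (q : ℝ → Fin D),
      IsL2Signal u → IsPiecewiseContinuous q → S₁.contIOMap u q = S₂.contIOMap u q
  | .discreteTime => ∀ (u : ℕ → Fin m → ℝ) (q : ℕ → Fin D),
      Isl2Sequence u → S₁.discIOMap u q = S₂.discIOMap u q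

/-- `S` is minimal: no realization of its input-output map has a smaller dimension. -/
def IsMinimal (τ : TimeDomain) (S : LSS D m p n) : Prop :=
  ∀ (n' : ℕ) (S' : LSS D m p n'), Equivalent τ S' S → n ≤ n'

/-! ### Grammians -/

/-- The left-hand side of the observability inequality for the mode `q`. -/
def obsLMI (τ : TimeDomain) (S : LSS D m p n) (q : Fin D) (Q : Matrix (Fin n) (Fin n) ℝ) :
    Matrix (Fin n) (Fin n) ℝ :=
  match τ with
  | .continuousTime => (S.A q).transpose * Q + Q * S.A q + (S.C q).transpose * S.C q
  | .discreteTime => (S.A q).transpose * Q * S.A q + (S.C q).transpose * S.C q - Q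

/-- The left-hand side of the controllability inequality for the mode `q`. -/
def ctrLMI (τ : TimeDomain) (S : LSS D m p n) (q : Fin D) (P : Matrix (Fin n) (Fin n) ℝ) :
    Matrix (Fin n) (Fin n) ℝ :=
  match τ with
  | .continuousTime => S.A q * P + P * (S.A q).transpose + S.B q * (S.B q).transpose
  | .discreteTime => S.A q * P * (S.A q).transpose + S.B q * (S.B q).transpose - P

/-- `Q > 0` solves the observability inequality, which says that its left-hand side is negative
semidefinite, for every mode. -/
def IsObservabilityGrammian (τ : TimeDomain) (S : LSS D m p n)
    (Q : Matrix (Fin n) (Fin n) ℝ) : Prop :=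
  Q.PosDef ∧ ∀ q : Fin D, (-(S.obsLMI τ q Q)).PosSemidef

/-- `P > 0` solves the controllability inequality for every mode. -/
def IsControllabilityGrammian (τ : TimeDomain) (S : LSS D m p n)
    (P : Matrix (Fin n) (Fin n) ℝ) : Prop :=
  P.PosDef ∧ ∀ q : Fin D, (-(S.ctrLMI τ q P)).PosSemidef

/-- `(P, Q)` is a pair of a controllability and an observability grammian of `S`. -/
def IsGrammianPair (τ : TimeDomain) (S : LSS D m p n) (P Q : Matrix (Fin n) (Fin n) ℝ) : Prop :=
  S.IsControllabilityGrammian τ P ∧ S.IsObservabilityGrammian τ Q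

end LSS

/-- The singular values of a pair of grammians: the eigenvalues of `P * Q`, with multiplicity.
They are all real, as `P` and `Q` are positive definite. -/
noncomputable def grammianSingularValues {n : ℕ} (P Q : Matrix (Fin n) (Fin n) ℝ) : Multiset ℝ :=
  (P * Q).charpoly.roots

/-! Equivalent minimal systems are isomorphic: some invertible `T` satisfies `T A = A' T`, `T B =
B'` and `C = C' T` in every mode. Then `T P Tᵀ` and `T⁻ᵀ Q T⁻¹` are grammians of the second system,
because the matrix inequalities transform by congruence, and their product `T (P Q) T⁻¹` is similar
to `P Q`.

The isomorphism is obtained directly from trajectories. Let `V` be the span of all pairs of states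
that the two systems reach together under the same input and switching signal. Since a signal may be
altered from any time on, `V` is invariant under the paired `A` matrices, contains the images of the
paired `B` matrices, and the two outputs agree on it (`Equivalent.exists_invariant_submodule`).
Minimality enters twice: restricting to an invariant subspace containing all inputs, or dividing by
an unobservable invariant subspace, gives an equivalent system and so cannot lower the dimension.
The first makes both projections of `V` surjective, the second makes them injective, so `V` is the
graph of `T` (`Equivalent.exists_linearEquiv`).

In continuous time this needs existence and uniqueness of Carathéodory solutions for measurable
data, and one-sided differentiability where the signals are locally constant; the analytic part
supplies these. -/

/-! ### Integral equations -/

section IntegralEquation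

variable {E : Type*} [NormedAddCommGroup E]

/-- A Carathéodory right-hand side of linear growth evaluated along a continuous curve is
integrable on intervals. -/
theorem intervalIntegrable_caratheodory {Φ : ℝ → E → E} {K a : ℝ} {φ : ℝ → ℝ}
    (hmeas : ∀ f : ℝ → E, Continuous f → AEStronglyMeasurable (fun s => Φ s (f s)) volume)
    (hlip : ∀ s v w, ‖Φ s v - Φ s w‖ ≤ K * ‖v - w‖)
    (hφ : Integrable φ) (h0 : ∀ s, ‖Φ s 0‖ ≤ a + φ s) {f : ℝ → E} (hf : Continuous f) (b c : ℝ) :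
    IntervalIntegrable (fun s => Φ s (f s)) volume b c := by
  have h1 : IntervalIntegrable (fun s => K * ‖f s‖ + (a + φ s)) volume b c :=
    ((continuous_const.mul hf.norm).intervalIntegrable b c).add
      (intervalIntegrable_const.add hφ.intervalIntegrable)
  refine h1.mono_fun' (hmeas f hf).restrict (ae_of_all _ fun s => ?_)
  calc ‖Φ s (f s)‖ = ‖(Φ s (f s) - Φ s 0) + Φ s 0‖ := by rw [sub_add_cancel]
    _ ≤ K * ‖f s - 0‖ + (a + φ s) := (norm_add_le _ _).trans (add_le_add (hlip _ _ _) (h0 s))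
    _ = _ := by rw [sub_zero]

/-- A continuous function bounded by a multiple of its own primitive vanishes. -/
theorem eqOn_zero_of_norm_le_mul_integral {z : ℝ → E} {K T : ℝ} (hz : ContinuousOn z (Icc 0 T))
    (h : ∀ t ∈ Icc 0 T, ‖z t‖ ≤ K * ∫ s in (0 : ℝ)..t, ‖z s‖) :
    ∀ t ∈ Icc 0 T, z t = 0 := by
  intro t ht
  have hT : 0 ≤ T := ht.1.trans ht.2
  -- Extending `‖z‖` continuously to the line makes its primitive differentiable everywhere;
  -- Gronwall is applied to that primitive, with zero initial value.
  let w : ℝ → ℝ := IccExtend hT ((Icc 0 T).domRestrict fun s => ‖z s‖)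
  have hw : Continuous w := (continuousOn_iff_continuous_domRestrict.1 hz.norm).Icc_extend'
  have hwz (s : ℝ) (hs : s ∈ Icc 0 T) : w s = ‖z s‖ := by
    simp [w, IccExtend_of_mem hT _ hs, Set.domRestrict]
  have hint (s : ℝ) (hs : s ∈ Icc 0 T) : ∫ r in (0 : ℝ)..s, ‖z r‖ = ∫ r in (0 : ℝ)..s, w r := by
    refine intervalIntegral.integral_congr fun r hr => ?_
    rw [uIcc_of_le hs.1] at hr
    exact (hwz r ⟨hr.1, hr.2.trans hs.2⟩).symm
  have hw0 (s : ℝ) : 0 ≤ w s := norm_nonneg _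
  have hW := norm_le_gronwallBound_of_norm_deriv_right_le (f := fun s => ∫ r in (0 : ℝ)..s, w r)
    (f' := w) (δ := 0) (K := K) (ε := 0) (a := 0) (b := T)
    (intervalIntegral.continuous_primitive (fun _ _ => hw.intervalIntegrable _ _) 0).continuousOn
    (fun s _ => (hw.integral_hasStrictDerivAt 0 s).hasDerivAt.hasDerivWithinAt) (by simp)
    (fun s hs => by
      have hs' : s ∈ Icc 0 T := ⟨hs.1, hs.2.le⟩
      have := h s hs'
      rw [hint s hs', ← hwz s hs'] at this
      rwa [Real.norm_of_nonneg (hw0 s), add_zero, Real.norm_of_nonneg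
        (intervalIntegral.integral_nonneg hs.1 fun r _ => hw0 r)]) t ht
  rw [gronwallBound_ε0_δ0] at hW
  have h1 := h t ht
  rw [hint t ht, norm_le_zero_iff.1 hW, mul_zero] at h1
  exact norm_le_zero_iff.1 h1

variable [NormedSpace ℝ E]

theorem integral_exp_mul_le {c t : ℝ} (hc : 0 < c) :
    ∫ s in (0 : ℝ)..t, Real.exp (c * s) ≤ Real.exp (c * t) / c := by
  have h : ∫ s in (0 : ℝ)..t, Real.exp (c * s) = (Real.exp (c * t) - 1) / c := by
    rw [intervalIntegral.integral_comp_mul_left (fun s => Real.exp s) hc.ne', integral_exp]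
    simp [div_eq_inv_mul]
  rw [h]
  gcongr
  linarith

/-- Global existence for integral equations with a Carathéodory right-hand side which is uniformly
Lipschitz in the state. -/
theorem exists_continuous_integral_eq [CompleteSpace E] {Φ : ℝ → E → E} {K a : ℝ} {φ : ℝ → ℝ}
    (hK : 0 ≤ K) (ha : 0 ≤ a)
    (hmeas : ∀ f : ℝ → E, Continuous f → AEStronglyMeasurable (fun s => Φ s (f s)) volume)
    (hlip : ∀ s v w, ‖Φ s v - Φ s w‖ ≤ K * ‖v - w‖)
    (hφ : Integrable φ) (hφ0 : ∀ s, 0 ≤ φ s) (h0 : ∀ s, ‖Φ s 0‖ ≤ a + φ s) :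
    ∃ x : ℝ → E, Continuous x ∧ ∀ t, 0 ≤ t → x t = ∫ s in (0 : ℝ)..t, Φ s (x s) := by
  -- The unknown is `g`, with `x s = exp (c * s) • g s`. In this exponentially weighted norm the
  -- Picard map has Lipschitz constant at most `K / c ≤ 1 / 2` on the whole half-line, so one fixed
  -- point gives a global solution. The bound `c ≥ 1` yields `T ≤ exp (c * T)`, which absorbs the
  -- linear growth term.
  set c : ℝ := 2 * K + 1 with hc
  have hc0 : 0 < c := by positivity
  have hc1 : 1 ≤ c := by linarith
  have hII := fun {f : ℝ → E} (hf : Continuous f) b d =>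
    intervalIntegrable_caratheodory hmeas hlip hφ h0 hf b d
  have hcont (g : BoundedContinuousFunction ℝ E) :
      Continuous fun s => Real.exp (c * s) • g s := by fun_prop
  let G (g : ℝ → E) (t : ℝ) : E :=
    Real.exp (-(c * max t 0)) • ∫ s in (0 : ℝ)..max t 0, Φ s (Real.exp (c * s) • g s)
  have hGcont (g : BoundedContinuousFunction ℝ E) : Continuous (G g) := by
    have := (intervalIntegral.continuous_primitive (hII (hcont g)) 0).comp
      (continuous_id.max continuous_const : Continuous fun t : ℝ => max t 0)
    exact Continuous.smul (by fun_prop) this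
  have hexp (t : ℝ) : Real.exp (-t) * Real.exp t = 1 := by rw [← Real.exp_add]; simp
  have hGbound (g : BoundedContinuousFunction ℝ E) (t : ℝ) :
      ‖G g t‖ ≤ K * ‖g‖ / c + (a + ∫ s, φ s) := by
    obtain ⟨T, hT⟩ : ∃ T, T = max t 0 := ⟨_, rfl⟩
    have hT0 : 0 ≤ T := hT ▸ le_max_right _ _
    have hφI : 0 ≤ ∫ s, φ s := integral_nonneg hφ0
    have key : ‖∫ s in (0 : ℝ)..T, Φ s (Real.exp (c * s) • g s)‖ ≤
        K * ‖g‖ * (Real.exp (c * T) / c) + (a * T + ∫ s, φ s) := by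
      have hi1 : IntervalIntegrable (fun s => K * ‖g‖ * Real.exp (c * s)) volume 0 T :=
        Continuous.intervalIntegrable (by fun_prop) _ _
      have hi2 : IntervalIntegrable (fun s => a + φ s) volume 0 T :=
        intervalIntegrable_const.add hφ.intervalIntegrable
      refine (intervalIntegral.norm_integral_le_of_norm_le hT0
        (g := fun s => K * ‖g‖ * Real.exp (c * s) + (a + φ s))
        (ae_of_all _ fun s _ => ?_) (hi1.add hi2)).trans ?_
      · have h1 := hlip s (Real.exp (c * s) • g s) 0
        rw [sub_zero, norm_smul, Real.norm_of_nonneg (Real.exp_pos _).le] at h1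
        have h2 : ‖Φ s (Real.exp (c * s) • g s)‖ ≤
            ‖Φ s (Real.exp (c * s) • g s) - Φ s 0‖ + ‖Φ s 0‖ := by
          simpa using norm_add_le (Φ s (Real.exp (c * s) • g s) - Φ s 0) (Φ s 0)
        have h3 : K * (Real.exp (c * s) * ‖g s‖) ≤ K * ‖g‖ * Real.exp (c * s) := by
          rw [mul_assoc, mul_comm ‖g‖]
          gcongr
          exact g.norm_coe_le_norm s
        linarith [h0 s]
      · rw [intervalIntegral.integral_add hi1 hi2, intervalIntegral.integral_add
          intervalIntegrable_const hφ.intervalIntegrable, intervalIntegral.integral_const_mul]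
        have h4 : ∫ s in (0 : ℝ)..T, φ s ≤ ∫ s, φ s := by
          rw [intervalIntegral.integral_of_le hT0]
          exact setIntegral_le_integral hφ (ae_of_all _ hφ0)
        have h5 := mul_le_mul_of_nonneg_left (integral_exp_mul_le (t := T) hc0)
          (mul_nonneg hK (norm_nonneg g))
        simp only [intervalIntegral.integral_const, sub_zero, smul_eq_mul]
        linarith
    have hG : ‖G g t‖ = Real.exp (-(c * T)) *
        ‖∫ s in (0 : ℝ)..T, Φ s (Real.exp (c * s) • g s)‖ := by
      simp only [G, norm_smul, Real.norm_of_nonneg (Real.exp_pos _).le, ← hT]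
    have hTe : Real.exp (-(c * T)) * T ≤ 1 := by
      have : T ≤ Real.exp (c * T) := by
        have := Real.add_one_le_exp (c * T)
        nlinarith
      calc _ ≤ Real.exp (-(c * T)) * Real.exp (c * T) := by gcongr
        _ = 1 := hexp _
    have he1 : Real.exp (-(c * T)) ≤ 1 := Real.exp_le_one_iff.2 (by nlinarith)
    rw [hG]
    calc _ ≤ Real.exp (-(c * T)) *
          (K * ‖g‖ * (Real.exp (c * T) / c) + (a * T + ∫ s, φ s)) := by gcongr
      _ = K * ‖g‖ / c * (Real.exp (-(c * T)) * Real.exp (c * T)) +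
          (a * (Real.exp (-(c * T)) * T) + Real.exp (-(c * T)) * ∫ s, φ s) := by ring
      _ ≤ K * ‖g‖ / c * 1 + (a * 1 + 1 * ∫ s, φ s) := by rw [hexp]; gcongr
      _ = _ := by ring
  let F (g : BoundedContinuousFunction ℝ E) : BoundedContinuousFunction ℝ E :=
    BoundedContinuousFunction.ofNormedAddCommGroup (G g) (hGcont g) _ (hGbound g)
  have hF : ContractingWith (1 / 2) F := by
    refine ⟨NNReal.half_lt_self one_ne_zero, LipschitzWith.of_dist_le_mul fun g h => ?_⟩
    rw [BoundedContinuousFunction.dist_le (by positivity)]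
    intro t
    obtain ⟨T, hT⟩ : ∃ T, T = max t 0 := ⟨_, rfl⟩
    have hT0 : 0 ≤ T := hT ▸ le_max_right _ _
    have key : ‖∫ s in (0 : ℝ)..T, (Φ s (Real.exp (c * s) • g s) - Φ s (Real.exp (c * s) • h s))‖ ≤
        K * dist g h * (Real.exp (c * T) / c) := by
      refine (intervalIntegral.norm_integral_le_of_norm_le hT0
        (g := fun s => K * dist g h * Real.exp (c * s))
        (ae_of_all _ fun s _ => ?_) (Continuous.intervalIntegrable (by fun_prop) _ _)).trans ?_
      · refine (hlip _ _ _).trans ?_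
        rw [← smul_sub, norm_smul, Real.norm_of_nonneg (Real.exp_pos _).le, ← dist_eq_norm,
          mul_assoc, mul_comm (dist g h)]
        gcongr
        exact BoundedContinuousFunction.dist_coe_le_dist s
      · rw [intervalIntegral.integral_const_mul]
        exact mul_le_mul_of_nonneg_left (integral_exp_mul_le hc0) (by positivity)
    have hG : dist (F g t) (F h t) = Real.exp (-(c * T)) *
        ‖∫ s in (0 : ℝ)..T, (Φ s (Real.exp (c * s) • g s) - Φ s (Real.exp (c * s) • h s))‖ := by
      rw [intervalIntegral.integral_sub (hII (hcont g) _ _) (hII (hcont h) _ _), dist_eq_norm]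
      change ‖G g t - G h t‖ = _
      simp only [G, ← smul_sub, norm_smul, Real.norm_of_nonneg (Real.exp_pos _).le, ← hT]
    have hKc : K / c ≤ 1 / 2 := by rw [div_le_div_iff₀ hc0 two_pos]; linarith
    rw [hG]
    calc _ ≤ Real.exp (-(c * T)) * (K * dist g h * (Real.exp (c * T) / c)) := by gcongr
      _ = K / c * dist g h * (Real.exp (-(c * T)) * Real.exp (c * T)) := by ring
      _ ≤ 1 / 2 * dist g h := by rw [hexp, mul_one]; gcongr
      _ = _ := by simp
  have hfix : F (hF.fixedPoint F) = hF.fixedPoint F := hF.fixedPoint_isFixedPt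
  obtain ⟨g, hg⟩ : ∃ g, g = hF.fixedPoint F := ⟨_, rfl⟩
  rw [← hg] at hfix
  refine ⟨fun s => Real.exp (c * s) • g s, hcont g, fun t ht => ?_⟩
  have h1 : g t = G g t := congrArg (fun f : BoundedContinuousFunction ℝ E => f t) hfix.symm
  simp only [h1, G, max_eq_left ht, smul_smul]
  rw [← Real.exp_add, add_neg_cancel, Real.exp_zero, one_smul]

end IntegralEquation

/-! ### Absolute continuity of vector-valued functions -/

section AbsolutelyContinuous

variable {X Y : Type*} [PseudoMetricSpace X] [PseudoMetricSpace Y]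

theorem LipschitzWith.comp_absolutelyContinuousOnInterval {C : NNReal} {g : X → Y}
    (hg : LipschitzWith C g) {f : ℝ → X} {a b : ℝ} (hf : AbsolutelyContinuousOnInterval f a b) :
    AbsolutelyContinuousOnInterval (fun t => g (f t)) a b := by
  refine squeeze_zero (fun t => Finset.sum_nonneg fun i _ => dist_nonneg) (fun t => ?_)
    (by simpa using Tendsto.const_mul (C : ℝ) hf)
  rw [Finset.mul_sum]
  exact Finset.sum_le_sum fun i _ => hg.dist_le_mul _ _

theorem absolutelyContinuousOnInterval_pi {ι : Type*} [Fintype ι] {f : ℝ → ι → ℝ} {a b : ℝ}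
    (hf : ∀ i, AbsolutelyContinuousOnInterval (fun t => f t i) a b) :
    AbsolutelyContinuousOnInterval f a b := by
  refine squeeze_zero (fun t => Finset.sum_nonneg fun i _ => dist_nonneg) (fun t => ?_)
    (by simpa using tendsto_finsetSum Finset.univ fun i _ => hf i)
  rw [Finset.sum_comm]
  refine Finset.sum_le_sum fun k _ => (dist_pi_le_iff (by positivity)).2 fun i => ?_
  exact Finset.single_le_sum (f := fun j => dist (f (t.2 k).1 j) (f (t.2 k).2 j))
    (fun j _ => dist_nonneg) (Finset.mem_univ i)

theorem absolutelyContinuousOnInterval_integral_pi {k : ℕ} {f : ℝ → Fin k → ℝ} {a b : ℝ}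
    (h : IntervalIntegrable f volume a b) :
    AbsolutelyContinuousOnInterval (fun t => ∫ s in a..t, f s) a b := by
  refine absolutelyContinuousOnInterval_pi fun i => ?_
  have hi : IntervalIntegrable (fun s => f s i) volume a b :=
    ⟨h.1.eval i, h.2.eval i⟩
  have h1 := hi.absolutelyContinuousOnInterval_intervalIntegral (c := a) left_mem_uIcc
  refine squeeze_zero' (Eventually.of_forall fun t => Finset.sum_nonneg fun i _ => dist_nonneg)
    ?_ h1
  -- The filter only sees families of subintervals of `[a, b]`, where `f` is integrable and
  -- coordinates commute with the integral.
  refine eventually_inf_principal.2 (Eventually.of_forall fun t ht => le_of_eq ?_)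
  refine Finset.sum_congr rfl fun j hj => ?_
  have hsub (r : ℝ) (hr : r ∈ uIcc a b) :
      (∫ s in a..r, f s) i = ∫ s in a..r, f s i :=
    ((ContinuousLinearMap.proj (R := ℝ) (φ := fun _ : Fin k => ℝ) i).intervalIntegral_comp_comm
      (h.mono_set (uIcc_subset_uIcc left_mem_uIcc hr))).symm
  have := ht.1 j hj
  simp only [hsub _ this.1, hsub _ this.2]

/-- The fundamental theorem of calculus for absolutely continuous vector-valued functions. -/
theorem AbsolutelyContinuousOnInterval.eq_add_integral {k : ℕ} {x G : ℝ → Fin k → ℝ} {a b : ℝ}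
    (hx : AbsolutelyContinuousOnInterval x a b) (hG : IntervalIntegrable G volume a b)
    (hd : ∀ᵐ t, t ∈ uIcc a b → HasDerivAt x (G t) t) {t : ℝ} (ht : t ∈ uIcc a b) :
    x t = x a + ∫ s in a..t, G s := by
  have hAC := hx.sub (absolutelyContinuousOnInterval_integral_pi hG)
  obtain ⟨C, hC⟩ := hAC.const_of_ae_hasDerivAt_zero (by
    filter_upwards [hd, hG.ae_hasDerivAt_integral] with s h1 h2 hs
    simpa using (h1 hs).sub (h2 hs a left_mem_uIcc))
  have h1 := hC t ht
  have h2 := hC a left_mem_uIcc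
  simp only [Pi.sub_apply, intervalIntegral.integral_same, sub_zero] at h1 h2
  rw [← h2] at h1
  exact (sub_eq_iff_eq_add.1 h1)

end AbsolutelyContinuous

/-! ### Signals -/

theorem exists_norm_mulVec_le {D k l : ℕ} (M : Fin D → Matrix (Fin k) (Fin l) ℝ) :
    ∃ K : ℝ, 0 ≤ K ∧ ∀ q v, ‖(M q).mulVec v‖ ≤ K * ‖v‖ := by
  refine ⟨∑ q, ‖(Matrix.mulVecLin (M q)).toContinuousLinearMap‖, by positivity, fun q v => ?_⟩
  refine ((Matrix.mulVecLin (M q)).toContinuousLinearMap.le_opNorm v).trans ?_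
  gcongr
  exact Finset.single_le_sum
    (f := fun j => ‖(Matrix.mulVecLin (M j)).toContinuousLinearMap‖)
    (fun j _ => norm_nonneg _) (Finset.mem_univ q)

theorem IsPiecewiseContinuous.aestronglyMeasurable {D : ℕ} {q : ℝ → Fin D}
    (hq : IsPiecewiseContinuous q) : AEStronglyMeasurable q (volume.restrict (Ici 0)) := by
  set N : Set ℝ := {t | t ∈ Ici (0 : ℝ) ∧ ¬ ContinuousWithinAt q (Ici 0) t} with hN
  have hNc : N.Countable := by
    refine (countable_iUnion fun b : ℕ => (hq.1 b).countable).mono fun t ht => ?_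
    obtain ⟨b, hb⟩ := exists_nat_ge t
    exact mem_iUnion.2 ⟨b, ⟨ht.1, hb⟩, ht.2⟩
  have hcont : ContinuousOn q (Ici 0 \ N) := fun t ht =>
    (not_not.1 fun h => ht.2 ⟨ht.1, h⟩ : ContinuousWithinAt q (Ici 0) t).mono sdiff_subset
  have h1 := hcont.aestronglyMeasurable (μ := volume) (measurableSet_Ici.diff hNc.measurableSet)
  rwa [Measure.restrict_congr_set (sdiff_null_ae_eq_self (hNc.measure_zero volume))] at h1

theorem aestronglyMeasurable_mulVec {D k l : ℕ} (M : Fin D → Matrix (Fin k) (Fin l) ℝ)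
    {q : ℝ → Fin D} {f : ℝ → Fin l → ℝ} {μ : Measure ℝ} (hq : AEStronglyMeasurable q μ)
    (hf : AEStronglyMeasurable f μ) :
    AEStronglyMeasurable (fun s => (M (q s)).mulVec (f s)) μ := by
  have hc : Continuous fun z : Fin D × (Fin l → ℝ) => (M z.1).mulVec z.2 :=
    continuous_prod_of_discrete_left.2 fun i =>
      show Continuous fun x => (M i).mulVec x from continuous_const.matrix_mulVec continuous_id
  exact hc.comp_aestronglyMeasurable (hq.prodMk hf)

/-- Dominates a square-integrable input by a constant plus an integrable function, the growth bound
required for existence of solutions. -/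
theorem norm_le_one_add_sum_sq {k : ℕ} (v : Fin k → ℝ) : ‖v‖ ≤ 1 + ∑ i, v i ^ 2 := by
  have h0 : 0 ≤ ∑ i, v i ^ 2 := Finset.sum_nonneg fun i _ => sq_nonneg _
  refine (pi_norm_le_iff_of_nonneg (by linarith)).2 fun i => ?_
  have h1 := Finset.single_le_sum (f := fun i => v i ^ 2) (fun i _ => sq_nonneg _)
    (Finset.mem_univ i)
  have h2 : |v i| ≤ 1 + v i ^ 2 := by
    rw [← sq_abs]
    nlinarith [sq_nonneg (|v i| - 1)]
  exact h2.trans (by simpa using h1)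

/-- Modes form a discrete space, so a one-sided limit is attained near the point. -/
theorem IsPiecewiseContinuous.exists_eventually_eq_right {D : ℕ} {q : ℝ → Fin D}
    (hq : IsPiecewiseContinuous q) {t : ℝ} (ht : 0 ≤ t) : ∃ i, ∀ᶠ s in 𝓝[>] t, q s = i := by
  obtain ⟨i, hi⟩ := hq.2.1 t ht
  exact ⟨i, hi.eventually (IsOpen.mem_nhds (isOpen_discrete {i}) rfl)⟩

theorem IsPiecewiseContinuous.exists_eventually_eq_left {D : ℕ} {q : ℝ → Fin D}
    (hq : IsPiecewiseContinuous q) {t : ℝ} (ht : 0 < t) : ∃ i, ∀ᶠ s in 𝓝[<] t, q s = i := by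
  obtain ⟨i, hi⟩ := hq.2.2 t ht
  exact ⟨i, hi.eventually (IsOpen.mem_nhds (isOpen_discrete {i}) rfl)⟩

theorem IsPiecewiseContinuous.mulVec {D k l : ℕ} {q : ℝ → Fin D} (hq : IsPiecewiseContinuous q)
    (M : Fin D → Matrix (Fin k) (Fin l) ℝ) {x : ℝ → Fin l → ℝ} (hx : ContinuousOn x (Ici 0)) :
    IsPiecewiseContinuous fun t => (M (q t)).mulVec (x t) := by
  have hM (i : Fin D) {F : Filter ℝ} {v : Fin l → ℝ} (h : Tendsto x F (𝓝 v)) :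
      Tendsto (fun s => (M i).mulVec (x s)) F (𝓝 ((M i).mulVec v)) :=
    ((continuous_const.matrix_mulVec continuous_id).tendsto v).comp h
  refine ⟨fun b => (hq.1 b).subset fun t ht => ⟨ht.1, fun hc => ht.2 ?_⟩, fun t ht => ?_,
    fun t ht => ?_⟩
  · have he : ∀ᶠ s in 𝓝[Ici 0] t, q s = q t :=
      hc.eventually (IsOpen.mem_nhds (isOpen_discrete {q t}) rfl)
    refine (hM (q t) (hx t ht.1.1)).congr' ?_
    filter_upwards [he] with s hs
    rw [hs]
  · obtain ⟨i, hi⟩ := hq.exists_eventually_eq_right ht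
    refine ⟨_, (hM i ((hx t ht).mono_left
      (nhdsWithin_mono t fun s hs => ht.trans (le_of_lt hs)))).congr' ?_⟩
    filter_upwards [hi] with s hs
    rw [hs]
  · obtain ⟨i, hi⟩ := hq.exists_eventually_eq_left ht
    refine ⟨_, (hM i (((hx t ht.le).continuousAt (Ici_mem_nhds ht)).tendsto.mono_left
      nhdsWithin_le_nhds)).congr' ?_⟩
    filter_upwards [hi] with s hs
    rw [hs]

/-- Switching to the constant mode `i` at time `t`. -/
theorem IsPiecewiseContinuous.ite_lt {D : ℕ} {q : ℝ → Fin D} (hq : IsPiecewiseContinuous q)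
    (t : ℝ) (i : Fin D) : IsPiecewiseContinuous fun s => if s < t then q s else i := by
  have hlt {s : ℝ} (hs : s < t) : (fun s => if s < t then q s else i) =ᶠ[𝓝 s] q := by
    filter_upwards [Iio_mem_nhds hs] with r hr
    exact if_pos hr
  have hgt {s : ℝ} (hs : t < s) : (fun s => if s < t then q s else i) =ᶠ[𝓝 s] fun _ => i := by
    filter_upwards [Ioi_mem_nhds hs] with r hr
    exact if_neg (not_lt.2 (le_of_lt hr))
  refine ⟨fun b => ((hq.1 b).union (finite_singleton t)).subset fun s hs => ?_, fun s hs => ?_,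
    fun s hs => ?_⟩
  · rcases lt_trichotomy s t with h | h | h
    · exact Or.inl ⟨hs.1, fun hc => hs.2 (hc.congr_of_eventuallyEq
        ((hlt h).filter_mono nhdsWithin_le_nhds) (hlt h).self_of_nhds)⟩
    · exact Or.inr h
    · exact absurd (continuousWithinAt_const.congr_of_eventuallyEq
        ((hgt h).filter_mono nhdsWithin_le_nhds) (hgt h).self_of_nhds) hs.2
  · rcases lt_or_ge s t with h | h
    · obtain ⟨l, hl⟩ := hq.2.1 s hs
      exact ⟨l, hl.congr' ((hlt h).filter_mono nhdsWithin_le_nhds).symm⟩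
    · refine ⟨i, tendsto_const_nhds.congr' ?_⟩
      filter_upwards [self_mem_nhdsWithin] with r hr
      exact (if_neg (not_lt.2 (h.trans (le_of_lt hr)))).symm
  · rcases le_or_gt s t with h | h
    · obtain ⟨l, hl⟩ := hq.2.2 s hs
      refine ⟨l, hl.congr' ?_⟩
      filter_upwards [self_mem_nhdsWithin] with r hr
      exact (if_pos (lt_of_lt_of_le hr h)).symm
    · exact ⟨i, tendsto_const_nhds.congr' ((hgt h).filter_mono nhdsWithin_le_nhds).symm⟩

theorem isPiecewiseContinuous_const {E : Type*} [TopologicalSpace E] (e : E) :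
    IsPiecewiseContinuous fun _ : ℝ => e :=
  ⟨fun _ => finite_empty.subset fun _ ht => ht.2 continuousWithinAt_const,
    fun _ _ => ⟨e, tendsto_const_nhds⟩, fun _ _ => ⟨e, tendsto_const_nhds⟩⟩

theorem isL2Signal_zero {k : ℕ} : IsL2Signal fun _ : ℝ => (0 : Fin k → ℝ) :=
  ⟨aestronglyMeasurable_const, by simp⟩

/-- Switching to the constant input `v` on `[t, t + 1)`, and to zero afterwards. -/
theorem IsL2Signal.ite_lt {k : ℕ} {u : ℝ → Fin k → ℝ} (hu : IsL2Signal u) (t : ℝ)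
    (v : Fin k → ℝ) :
    IsL2Signal fun s => if s < t then u s else if s < t + 1 then v else 0 := by
  constructor
  · exact AEStronglyMeasurable.piecewise (s := Iio t) measurableSet_Iio hu.1.restrict
      (((measurable_const.piecewise (s := Iio (t + 1)) measurableSet_Iio
        measurable_const).aestronglyMeasurable))
  · have h1 : IntegrableOn (fun s => (Iio t).indicator (fun s => ∑ i, u s i ^ 2) s) (Ici 0) :=
      hu.2.indicator measurableSet_Iio
    have h2 : Integrable (fun s => (Ico t (t + 1)).indicator (fun _ => ∑ i, v i ^ 2) s) :=
      (integrable_indicator_iff measurableSet_Ico).2 (integrableOn_const (by simp) (by simp))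
    refine (h1.add h2.integrableOn).congr (ae_of_all _ fun s => ?_)
    by_cases hs : s < t
    · simp [hs, indicator]
    · by_cases hs' : s < t + 1
      · simp [hs, hs', not_lt.1 hs, indicator]
      · simp [hs, hs', indicator]

namespace LSS

variable {D m p n : ℕ} {S : LSS D m p n}

/-! ### Continuous-time solutions -/

theorem IsContSolution.continuousOn {x₀ : Fin n → ℝ} {u : ℝ → Fin m → ℝ} {q : ℝ → Fin D}
    {x : ℝ → Fin n → ℝ} {y : ℝ → Fin p → ℝ} (h : S.IsContSolution x₀ u q x y) :
    ContinuousOn x (Ici 0) := by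
  intro t ht
  have h1 := (h.state_ac (t + 1) (by linarith [mem_Ici.1 ht])).continuousOn
  rw [uIcc_of_le (by linarith [mem_Ici.1 ht])] at h1
  refine (h1 t ⟨ht, by linarith⟩).mono_of_mem_nhdsWithin ?_
  rw [← Ici_inter_Iic]
  exact inter_mem_nhdsWithin _ (Iic_mem_nhds (by linarith))

theorem IsContSolution.ae_hasDerivAt {x₀ : Fin n → ℝ} {u : ℝ → Fin m → ℝ} {q : ℝ → Fin D}
    {x : ℝ → Fin n → ℝ} {y : ℝ → Fin p → ℝ} (h : S.IsContSolution x₀ u q x y) :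
    ∀ᵐ t, 0 ≤ t →
      HasDerivAt x ((S.A (q t)).mulVec (x t) + (S.B (q t)).mulVec (u t)) t :=
  (ae_restrict_iff' measurableSet_Ici).1 h.deriv

/-- The solution up to time `T` depends only on the input and the switching signal before `T`. -/
theorem IsContSolution.eqOn {x₀ : Fin n → ℝ} {u u' : ℝ → Fin m → ℝ} {q q' : ℝ → Fin D}
    {x x' : ℝ → Fin n → ℝ} {y y' : ℝ → Fin p → ℝ} (hq : IsPiecewiseContinuous q)
    (h : S.IsContSolution x₀ u q x y) (h' : S.IsContSolution x₀ u' q' x' y') {T : ℝ}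
    (hT : 0 ≤ T) (hu : ∀ t ∈ Ico 0 T, u t = u' t) (hqq : ∀ t ∈ Ico 0 T, q t = q' t) :
    ∀ t ∈ Icc 0 T, x t = x' t := by
  obtain ⟨K, hK0, hK⟩ := exists_norm_mulVec_le S.A
  -- The difference solves the homogeneous equation with zero initial value, so Gronwall applies.
  have hAC : AbsolutelyContinuousOnInterval (x - x') 0 T := (h.state_ac T hT).sub (h'.state_ac T hT)
  have hzc : ContinuousOn (x - x') (Icc 0 T) := by
    simpa [uIcc_of_le hT] using hAC.continuousOn
  have hG : IntervalIntegrable (fun s => (S.A (q s)).mulVec ((x - x') s)) volume 0 T := by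
    have h1 : IntervalIntegrable (fun s => K * ‖(x - x') s‖) volume 0 T :=
      ContinuousOn.intervalIntegrable (by
        rw [uIcc_of_le hT]; exact continuousOn_const.mul hzc.norm)
    refine h1.mono_fun' ?_ (ae_of_all _ fun s => hK _ _)
    rw [uIoc_of_le hT]
    exact aestronglyMeasurable_mulVec S.A
      (hq.aestronglyMeasurable.mono_set fun s hs => (le_of_lt hs.1 : (0 : ℝ) ≤ s))
      ((hzc.mono Ioc_subset_Icc_self).aestronglyMeasurable measurableSet_Ioc)
  have hd : ∀ᵐ t, t ∈ uIcc 0 T → HasDerivAt (x - x') ((S.A (q t)).mulVec ((x - x') t)) t := by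
    -- The signals may differ at `T` itself, so this null set is discarded.
    filter_upwards [h.ae_hasDerivAt, h'.ae_hasDerivAt,
      measure_eq_zero_iff_ae_notMem.1 (measure_singleton (μ := volume) T)] with t h1 h2 h3 ht
    rw [uIcc_of_le hT] at ht
    have ht' : t ∈ Ico 0 T := ⟨ht.1, lt_of_le_of_ne ht.2 h3⟩
    have h4 := (h1 ht.1).sub (h2 ht.1)
    rwa [← hu t ht', ← hqq t ht', add_sub_add_right_eq_sub, ← Matrix.mulVec_sub] at h4
  intro t ht
  refine sub_eq_zero.1 (eqOn_zero_of_norm_le_mul_integral (K := K) hzc (fun s hs => ?_) t ht)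
  have h5 := hAC.eq_add_integral hG hd (t := s) (by rwa [uIcc_of_le hT])
  rw [h5, Pi.sub_apply, h.init, h'.init, sub_self, zero_add,
    ← intervalIntegral.integral_const_mul]
  refine intervalIntegral.norm_integral_le_of_norm_le hs.1 (ae_of_all _ fun r _ => hK _ _) ?_
  refine ContinuousOn.intervalIntegrable ?_
  rw [uIcc_of_le hs.1]
  exact continuousOn_const.mul (hzc.mono (Icc_subset_Icc_right hs.2)).norm

theorem IsContSolution.unique {x₀ : Fin n → ℝ} {u : ℝ → Fin m → ℝ} {q : ℝ → Fin D}
    {x x' : ℝ → Fin n → ℝ} {y y' : ℝ → Fin p → ℝ} (hq : IsPiecewiseContinuous q)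
    (h : S.IsContSolution x₀ u q x y) (h' : S.IsContSolution x₀ u q x' y') {t : ℝ}
    (ht : 0 ≤ t) : x t = x' t :=
  h.eqOn hq h' ht (fun _ _ => rfl) (fun _ _ => rfl) t ⟨ht, le_rfl⟩

/-- Existence of solutions from the zero state. -/
theorem exists_isContSolution (S : LSS D m p n) {u : ℝ → Fin m → ℝ} {q : ℝ → Fin D}
    (hu : IsL2Signal u) (hq : IsPiecewiseContinuous q) :
    ∃ x, S.IsContSolution 0 u q x fun t => (S.C (q t)).mulVec (x t) := by
  obtain ⟨K, hK0, hK⟩ := exists_norm_mulVec_le S.A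
  obtain ⟨L, hL0, hL⟩ := exists_norm_mulVec_le S.B
  let Φ (s : ℝ) (v : Fin n → ℝ) : Fin n → ℝ :=
    (Ici (0 : ℝ)).indicator (fun s => (S.A (q s)).mulVec v + (S.B (q s)).mulVec (u s)) s
  let φ : ℝ → ℝ := (Ici (0 : ℝ)).indicator fun s => L * ∑ i, u s i ^ 2
  have hsq (s : ℝ) : 0 ≤ ∑ i, u s i ^ 2 := Finset.sum_nonneg fun i _ => sq_nonneg _
  have hmeas (f : ℝ → Fin n → ℝ) (hf : Continuous f) :
      AEStronglyMeasurable (fun s => Φ s (f s)) volume :=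
    (aestronglyMeasurable_indicator_iff (f := fun s =>
      (S.A (q s)).mulVec (f s) + (S.B (q s)).mulVec (u s)) measurableSet_Ici).2
      ((aestronglyMeasurable_mulVec S.A hq.aestronglyMeasurable hf.aestronglyMeasurable).add
        (aestronglyMeasurable_mulVec S.B hq.aestronglyMeasurable hu.1))
  have hlip (s : ℝ) (v w : Fin n → ℝ) : ‖Φ s v - Φ s w‖ ≤ K * ‖v - w‖ := by
    by_cases hs : s ∈ Ici (0 : ℝ)
    · simpa [Φ, indicator_of_mem hs, ← Matrix.mulVec_sub] using hK (q s) (v - w)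
    · simp only [Φ, indicator_of_notMem hs, sub_zero, norm_zero]
      positivity
  have hφ : Integrable φ := (integrable_indicator_iff measurableSet_Ici).2 (hu.2.const_mul L)
  have hφ0 (s : ℝ) : 0 ≤ φ s := indicator_nonneg (fun s _ => mul_nonneg hL0 (hsq s)) s
  have h0 (s : ℝ) : ‖Φ s 0‖ ≤ L + φ s := by
    by_cases hs : s ∈ Ici (0 : ℝ)
    · simp only [Φ, φ, indicator_of_mem hs, Matrix.mulVec_zero, zero_add]
      calc _ ≤ L * ‖u s‖ := hL _ _
        _ ≤ L * (1 + ∑ i, u s i ^ 2) := by gcongr; exact norm_le_one_add_sum_sq _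
        _ = _ := by ring
    · simpa [Φ, φ, indicator_of_notMem hs] using hL0
  obtain ⟨x, hxc, hx⟩ := exists_continuous_integral_eq hK0 hL0 hmeas hlip hφ hφ0 h0
  have hII := intervalIntegrable_caratheodory hmeas hlip hφ h0 hxc
  -- The primitive `z` serves as the state: it agrees with `x` for `t ≥ 0`, and its absolute
  -- continuity and derivative come straight from integration theory.
  set z : ℝ → Fin n → ℝ := fun t => ∫ s in (0 : ℝ)..t, Φ s (x s) with hz
  have hzc : Continuous z := intervalIntegral.continuous_primitive hII 0
  refine ⟨z, fun b _ => absolutelyContinuousOnInterval_integral_pi (hII 0 b),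
    hq.mulVec S.C hzc.continuousOn, intervalIntegral.integral_same, ?_, fun _ _ => rfl⟩
  have hloc : LocallyIntegrable (fun s => Φ s (x s)) := by
    refine fun r => ⟨Ioc (r - 1) (r + 1), Ioc_mem_nhds (by linarith) (by linarith), ?_⟩
    exact (intervalIntegrable_iff_integrableOn_Ioc_of_le (by linarith)).1 (hII _ _)
  refine (ae_restrict_iff' measurableSet_Ici).2 ?_
  filter_upwards [_root_.LocallyIntegrable.ae_hasDerivAt_integral hloc] with t ht ht0
  have h1 := ht 0
  rw [show Φ t (x t) = (S.A (q t)).mulVec (x t) + (S.B (q t)).mulVec (u t) from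
    indicator_of_mem ht0 _, hx t ht0] at h1
  exact h1

/-- If the mode and the input are constant on `[t, t + 1)`, the state is differentiable from the
right at `t`. -/
theorem IsContSolution.hasDerivWithinAt {x₀ : Fin n → ℝ} {u : ℝ → Fin m → ℝ} {q : ℝ → Fin D}
    {x : ℝ → Fin n → ℝ} {y : ℝ → Fin p → ℝ} (h : S.IsContSolution x₀ u q x y) {t : ℝ}
    (ht : 0 ≤ t) {i : Fin D} {v : Fin m → ℝ} (hq : ∀ s ∈ Ico t (t + 1), q s = i)
    (hu : ∀ s ∈ Ico t (t + 1), u s = v) :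
    HasDerivWithinAt x ((S.A i).mulVec (x t) + (S.B i).mulVec v) (Ici t) t := by
  have htt : t ≤ t + 1 := by linarith
  -- With mode and input frozen the integrand is continuous, so the integral equation gives a right
  -- derivative at `t` itself, not only almost everywhere.
  let G (s : ℝ) : Fin n → ℝ := (S.A i).mulVec (x s) + (S.B i).mulVec v
  have hGc : ContinuousOn G (Ici 0) :=
    (((continuous_const.matrix_mulVec continuous_id).comp_continuousOn h.continuousOn :
      ContinuousOn (fun s => (S.A i).mulVec (x s)) (Ici 0))).add continuousOn_const
  have hG : IntervalIntegrable G volume t (t + 1) := by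
    refine (hGc.mono ?_).intervalIntegrable
    rw [uIcc_of_le htt]
    exact fun s hs => ht.trans hs.1
  have hAC : AbsolutelyContinuousOnInterval x t (t + 1) := by
    refine (h.state_ac (t + 1) (by linarith)).mono ?_
    rw [uIcc_of_le htt, uIcc_of_le (by linarith)]
    exact Icc_subset_Icc_left ht
  have hd : ∀ᵐ s, s ∈ uIcc t (t + 1) → HasDerivAt x (G s) s := by
    filter_upwards [h.ae_hasDerivAt,
      measure_eq_zero_iff_ae_notMem.1 (measure_singleton (μ := volume) (t + 1))] with s h1 h3 hs
    rw [uIcc_of_le htt] at hs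
    have hs' : s ∈ Ico t (t + 1) := ⟨hs.1, lt_of_le_of_ne hs.2 h3⟩
    have := h1 (ht.trans hs.1)
    rwa [hq s hs', hu s hs'] at this
  have hx (s : ℝ) (hs : s ∈ Icc t (t + 1)) : x s = x t + ∫ r in t..s, G r :=
    hAC.eq_add_integral hG hd (by rwa [uIcc_of_le htt])
  have hmem : Icc t (t + 1) ∈ 𝓝[Ici t] t := by
    rw [← Ici_inter_Iic]
    exact inter_mem_nhdsWithin _ (Iic_mem_nhds (by linarith))
  have hderiv : HasDerivWithinAt (fun s => x t + ∫ r in t..s, G r) (G t) (Ici t) t := by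
    refine HasDerivWithinAt.const_add _
      (intervalIntegral.integral_hasDerivWithinAt_right (t := Ioi t) (by simp) ?_ ?_)
    · refine ⟨Ioi t, self_mem_nhdsWithin, ?_⟩
      exact (hGc.mono fun s hs => ht.trans (le_of_lt hs)).aestronglyMeasurable measurableSet_Ioi
    · exact (hGc t ht).mono fun s hs => ht.trans (le_of_lt hs)
  refine hderiv.congr_of_eventuallyEq ?_ (by simp)
  filter_upwards [hmem] with s hs
  exact hx s hs

end LSS

namespace LSS

variable {D m p n : ℕ}

/-! ### Discrete-time solutions -/

theorem IsDiscSolution.eq_of_le {S : LSS D m p n} {x₀ : Fin n → ℝ} {u u' : ℕ → Fin m → ℝ}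
    {q q' : ℕ → Fin D} {x x' : ℕ → Fin n → ℝ} {y y' : ℕ → Fin p → ℝ}
    (h : S.IsDiscSolution x₀ u q x y) (h' : S.IsDiscSolution x₀ u' q' x' y') {T : ℕ}
    (hu : ∀ t < T, u t = u' t) (hq : ∀ t < T, q t = q' t) : ∀ t ≤ T, x t = x' t := by
  intro t
  induction t with
  | zero => intro _; rw [h.init, h'.init]
  | succ t ih =>
    intro ht
    rw [h.step, h'.step, ih (by omega), hu t (by omega), hq t (by omega)]

theorem IsDiscSolution.unique {S : LSS D m p n} {x₀ : Fin n → ℝ} {u : ℕ → Fin m → ℝ}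
    {q : ℕ → Fin D} {x x' : ℕ → Fin n → ℝ} {y y' : ℕ → Fin p → ℝ}
    (h : S.IsDiscSolution x₀ u q x y) (h' : S.IsDiscSolution x₀ u q x' y') (t : ℕ) :
    x t = x' t :=
  h.eq_of_le h' (fun _ _ => rfl) (fun _ _ => rfl) t le_rfl

theorem exists_isDiscSolution (S : LSS D m p n) (x₀ : Fin n → ℝ) (u : ℕ → Fin m → ℝ)
    (q : ℕ → Fin D) : ∃ x, S.IsDiscSolution x₀ u q x fun t => (S.C (q t)).mulVec (x t) :=
  ⟨fun t => Nat.rec x₀ (fun t x => (S.A (q t)).mulVec x + (S.B (q t)).mulVec (u t)) t,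
    rfl, fun _ => rfl, fun _ => rfl⟩

/-! ### Homomorphisms -/

/-- A linear map intertwining the matrices of two systems. -/
structure IsHom {n' : ℕ} (S : LSS D m p n) (S' : LSS D m p n')
    (f : (Fin n → ℝ) →ₗ[ℝ] (Fin n' → ℝ)) : Prop where
  map_A : ∀ q x, f ((S.A q).mulVec x) = (S'.A q).mulVec (f x)
  map_B : ∀ q v, f ((S.B q).mulVec v) = (S'.B q).mulVec v
  map_C : ∀ q x, (S.C q).mulVec x = (S'.C q).mulVec (f x)

section IsHom

variable {n' : ℕ} {S : LSS D m p n} {S' : LSS D m p n'} {f : (Fin n → ℝ) →ₗ[ℝ] (Fin n' → ℝ)}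

theorem IsHom.map_isContSolution (hf : S.IsHom S' f) {x₀ : Fin n → ℝ} {u : ℝ → Fin m → ℝ}
    {q : ℝ → Fin D} {x : ℝ → Fin n → ℝ} {y : ℝ → Fin p → ℝ} (h : S.IsContSolution x₀ u q x y) :
    S'.IsContSolution (f x₀) u q (fun t => f (x t)) y where
  state_ac b hb :=
    f.toContinuousLinearMap.lipschitz.comp_absolutelyContinuousOnInterval (h.state_ac b hb)
  output_pc := h.output_pc
  init := by rw [h.init]
  deriv := by
    filter_upwards [h.deriv] with t ht
    have := f.toContinuousLinearMap.hasFDerivAt.comp_hasDerivAt t ht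
    simpa [hf.map_A, hf.map_B, Function.comp_def] using this
  output t ht := by rw [h.output t ht, hf.map_C]

theorem IsHom.map_isDiscSolution (hf : S.IsHom S' f) {x₀ : Fin n → ℝ} {u : ℕ → Fin m → ℝ}
    {q : ℕ → Fin D} {x : ℕ → Fin n → ℝ} {y : ℕ → Fin p → ℝ} (h : S.IsDiscSolution x₀ u q x y) :
    S'.IsDiscSolution (f x₀) u q (fun t => f (x t)) y where
  init := by rw [h.init]
  step t := by rw [h.step, map_add, hf.map_A, hf.map_B]
  output t := by rw [h.output t, hf.map_C]

/-- Trajectories push forward along `f` with the same output; conversely, by uniqueness every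
trajectory of `S'` from zero is such an image. Neither injectivity nor surjectivity of `f` is
needed. -/
theorem IsHom.equivalent (hf : S.IsHom S' f) (τ : TimeDomain) : Equivalent τ S S' := by
  cases τ with
  | continuousTime =>
    intro u q hu hq
    ext y
    constructor
    · rintro ⟨x, hx⟩
      exact ⟨_, map_zero f ▸ hf.map_isContSolution hx⟩
    · rintro ⟨x', hx'⟩
      obtain ⟨x, hx⟩ := S.exists_isContSolution hu hq
      have hfx := hf.map_isContSolution hx
      rw [map_zero] at hfx
      -- Output values at negative times are arbitrary, so the given `y` is kept and only the state
      -- is replaced.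
      refine ⟨x, hx.state_ac, hx'.output_pc, hx.init, hx.deriv, fun t ht => ?_⟩
      rw [hx'.output t ht, hx'.unique hq hfx ht, hf.map_C]
  | discreteTime =>
    intro u q _
    ext y
    constructor
    · rintro ⟨x, hx⟩
      exact ⟨_, map_zero f ▸ hf.map_isDiscSolution hx⟩
    · rintro ⟨x', hx'⟩
      obtain ⟨x, hx⟩ := S.exists_isDiscSolution 0 u q
      have hfx := hf.map_isDiscSolution hx
      rw [map_zero] at hfx
      refine ⟨x, hx.init, hx.step, fun t => ?_⟩
      rw [hx'.output t, hx'.unique hfx t, hf.map_C]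

end IsHom

theorem Equivalent.symm {n₁ n₂ : ℕ} {τ : TimeDomain} {S₁ : LSS D m p n₁} {S₂ : LSS D m p n₂}
    (h : Equivalent τ S₁ S₂) : Equivalent τ S₂ S₁ := by
  cases τ with
  | continuousTime => exact fun u q hu hq => (h u q hu hq).symm
  | discreteTime => exact fun u q hu => (h u q hu).symm

/-! ### States reached jointly by two systems -/

section Joint

variable {n₁ n₂ : ℕ}

/-- Pairs of states which two systems reach at the same time from zero under the same input and
switching signal. -/
def jointReach (τ : TimeDomain) (S₁ : LSS D m p n₁) (S₂ : LSS D m p n₂) :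
    Set ((Fin n₁ → ℝ) × (Fin n₂ → ℝ)) :=
  match τ with
  | .continuousTime => {w | ∃ u q x₁ y₁ x₂ y₂, ∃ t : ℝ, 0 ≤ t ∧ IsL2Signal u ∧
      IsPiecewiseContinuous q ∧ S₁.IsContSolution 0 u q x₁ y₁ ∧ S₂.IsContSolution 0 u q x₂ y₂ ∧
      w = (x₁ t, x₂ t)}
  | .discreteTime => {w | ∃ u q x₁ y₁ x₂ y₂, ∃ t : ℕ, Isl2Sequence u ∧
      S₁.IsDiscSolution 0 u q x₁ y₁ ∧ S₂.IsDiscSolution 0 u q x₂ y₂ ∧ w = (x₁ t, x₂ t)}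

/-- At least one mode is needed for a switching signal to exist. -/
theorem zero_mem_jointReach (τ : TimeDomain) (hD : 0 < D) (S₁ : LSS D m p n₁)
    (S₂ : LSS D m p n₂) : (0, 0) ∈ jointReach τ S₁ S₂ := by
  cases τ with
  | continuousTime =>
    have hq := isPiecewiseContinuous_const (⟨0, hD⟩ : Fin D)
    obtain ⟨x₁, h₁⟩ := S₁.exists_isContSolution isL2Signal_zero hq
    obtain ⟨x₂, h₂⟩ := S₂.exists_isContSolution isL2Signal_zero hq
    exact ⟨_, _, x₁, _, x₂, _, 0, le_rfl, isL2Signal_zero, hq, h₁, h₂, by rw [h₁.init, h₂.init]⟩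
  | discreteTime =>
    obtain ⟨x₁, h₁⟩ := S₁.exists_isDiscSolution 0 0 fun _ => ⟨0, hD⟩
    obtain ⟨x₂, h₂⟩ := S₂.exists_isDiscSolution 0 0 fun _ => ⟨0, hD⟩
    exact ⟨_, _, x₁, _, x₂, _, 0, by simp [Isl2Sequence, summable_zero], h₁, h₂,
      by rw [h₁.init, h₂.init]⟩

/-- Difference quotients stay in `V`, which is closed because the space is finite-dimensional. -/
theorem _root_.Submodule.mem_of_hasDerivWithinAt_Ici {F : Type*} [NormedAddCommGroup F]
    [NormedSpace ℝ F] [FiniteDimensional ℝ F] (V : Submodule ℝ F) {w : ℝ → F} {w' : F} {t : ℝ}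
    (h : HasDerivWithinAt w w' (Ici t) t) (hw : ∀ s, t ≤ s → w s ∈ V) : w' ∈ V := by
  have h1 := (hasDerivWithinAt_iff_tendsto_slope' (by simp)).1 h.Ioi_of_Ici
  refine V.closed_of_finiteDimensional.mem_of_tendsto h1 ?_
  filter_upwards [self_mem_nhdsWithin] with s hs
  exact V.smul_mem _ (V.sub_mem (hw s (le_of_lt hs)) (hw t le_rfl))

/-- From time `t` on, continue with mode `i` and input `v`, returning the input to zero later to
keep it square-summable or square-integrable. In discrete time the pair is the next joint state; in
continuous time it is the right derivative of a joint trajectory. Taking `v = 0` yields invariance,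
and taking the zero state yields the input directions. -/
theorem step_mem_span_jointReach (τ : TimeDomain) (S₁ : LSS D m p n₁) (S₂ : LSS D m p n₂)
    {w : (Fin n₁ → ℝ) × (Fin n₂ → ℝ)} (hw : w ∈ jointReach τ S₁ S₂) (i : Fin D)
    (v : Fin m → ℝ) :
    ((S₁.A i).mulVec w.1 + (S₁.B i).mulVec v, (S₂.A i).mulVec w.2 + (S₂.B i).mulVec v) ∈
      Submodule.span ℝ (jointReach τ S₁ S₂) := by
  cases τ with
  | continuousTime =>
    obtain ⟨u, q, x₁, y₁, x₂, y₂, t, ht, hu, hq, h₁, h₂, rfl⟩ := hw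
    have hu' := hu.ite_lt t v
    have hq' := hq.ite_lt t i
    obtain ⟨z₁, k₁⟩ := S₁.exists_isContSolution hu' hq'
    obtain ⟨z₂, k₂⟩ := S₂.exists_isContSolution hu' hq'
    have e₁ := h₁.eqOn hq k₁ ht (fun s hs => (if_pos hs.2).symm) (fun s hs => (if_pos hs.2).symm)
      t ⟨ht, le_rfl⟩
    have e₂ := h₂.eqOn hq k₂ ht (fun s hs => (if_pos hs.2).symm) (fun s hs => (if_pos hs.2).symm)
      t ⟨ht, le_rfl⟩
    have hqc (s : ℝ) (hs : s ∈ Ico t (t + 1)) : (if s < t then q s else i) = i :=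
      if_neg (not_lt.2 hs.1)
    have huc (s : ℝ) (hs : s ∈ Ico t (t + 1)) :
        (if s < t then u s else if s < t + 1 then v else 0) = v := by
      rw [if_neg (not_lt.2 hs.1), if_pos hs.2]
    have hd := (k₁.hasDerivWithinAt ht hqc huc).prodMk (k₂.hasDerivWithinAt ht hqc huc)
    simp only [e₁, e₂]
    exact Submodule.mem_of_hasDerivWithinAt_Ici _ hd fun s hs => Submodule.subset_span
      ⟨_, _, z₁, _, z₂, _, s, ht.trans hs, hu', hq', k₁, k₂, rfl⟩
  | discreteTime =>
    obtain ⟨u, q, x₁, y₁, x₂, y₂, t, hu, h₁, h₂, rfl⟩ := hw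
    let u' : ℕ → Fin m → ℝ := fun s => if s < t then u s else if s = t then v else 0
    let q' : ℕ → Fin D := fun s => if s < t then q s else i
    have hu' : Isl2Sequence u' := summable_of_ne_finset_zero (s := Finset.range (t + 1))
      fun s hs => by
        have hs : t < s := by simpa using hs
        simp [u', not_lt.2 hs.le, hs.ne']
    obtain ⟨z₁, k₁⟩ := S₁.exists_isDiscSolution 0 u' q'
    obtain ⟨z₂, k₂⟩ := S₂.exists_isDiscSolution 0 u' q'
    have e₁ := h₁.eq_of_le k₁ (fun s hs => (if_pos hs).symm) (fun s hs => (if_pos hs).symm) t le_rfl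
    have e₂ := h₂.eq_of_le k₂ (fun s hs => (if_pos hs).symm) (fun s hs => (if_pos hs).symm) t le_rfl
    have hqt : q' t = i := if_neg (lt_irrefl t)
    have hut : u' t = v := by simp [u']
    refine Submodule.subset_span ⟨u', q', z₁, _, z₂, _, t + 1, hu', k₁, k₂, ?_⟩
    rw [k₁.step, k₂.step, hqt, hut, e₁, e₂]

/-- Switching to mode `i` at time `t` leaves the states at `t` unchanged and makes the common output
there equal to both sides. -/
theorem Equivalent.output_eq {τ : TimeDomain} {S₁ : LSS D m p n₁} {S₂ : LSS D m p n₂}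
    (h : Equivalent τ S₁ S₂) {w : (Fin n₁ → ℝ) × (Fin n₂ → ℝ)} (hw : w ∈ jointReach τ S₁ S₂)
    (i : Fin D) : (S₁.C i).mulVec w.1 = (S₂.C i).mulVec w.2 := by
  cases τ with
  | continuousTime =>
    obtain ⟨u, q, x₁, y₁, x₂, y₂, t, ht, hu, hq, h₁, h₂, rfl⟩ := hw
    have hq' := hq.ite_lt t i
    obtain ⟨z₁, k₁⟩ := S₁.exists_isContSolution hu hq'
    obtain ⟨z₂, k₂⟩ := (h u _ hu hq').subset ⟨z₁, k₁⟩
    have e₁ := h₁.eqOn hq k₁ ht (fun _ _ => rfl) (fun s hs => (if_pos hs.2).symm) t ⟨ht, le_rfl⟩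
    have e₂ := h₂.eqOn hq k₂ ht (fun _ _ => rfl) (fun s hs => (if_pos hs.2).symm) t ⟨ht, le_rfl⟩
    simpa [e₁, e₂] using k₂.output t ht
  | discreteTime =>
    obtain ⟨u, q, x₁, y₁, x₂, y₂, t, hu, h₁, h₂, rfl⟩ := hw
    let q' : ℕ → Fin D := fun s => if s < t then q s else i
    obtain ⟨z₁, k₁⟩ := S₁.exists_isDiscSolution 0 u q'
    obtain ⟨z₂, k₂⟩ := (h u q' hu).subset ⟨z₁, k₁⟩
    have e₁ := h₁.eq_of_le k₁ (fun _ _ => rfl) (fun s hs => (if_pos hs).symm) t le_rfl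
    have e₂ := h₂.eq_of_le k₂ (fun _ _ => rfl) (fun s hs => (if_pos hs).symm) t le_rfl
    simpa [q', e₁, e₂] using k₂.output t

theorem Equivalent.exists_invariant_submodule (hD : 0 < D) {τ : TimeDomain} {S₁ : LSS D m p n₁}
    {S₂ : LSS D m p n₂} (h : Equivalent τ S₁ S₂) :
    ∃ V : Submodule ℝ ((Fin n₁ → ℝ) × (Fin n₂ → ℝ)),
      (∀ q v, ((S₁.B q).mulVec v, (S₂.B q).mulVec v) ∈ V) ∧
      (∀ q, ∀ w ∈ V, ((S₁.A q).mulVec w.1, (S₂.A q).mulVec w.2) ∈ V) ∧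
      ∀ q, ∀ w ∈ V, (S₁.C q).mulVec w.1 = (S₂.C q).mulVec w.2 := by
  have hstep := fun {w} (hw : w ∈ jointReach τ S₁ S₂) => step_mem_span_jointReach τ S₁ S₂ hw
  refine ⟨Submodule.span ℝ (jointReach τ S₁ S₂), fun q v => ?_, fun q w hw => ?_,
    fun q w hw => ?_⟩
  · simpa using hstep (zero_mem_jointReach τ hD S₁ S₂) q v
  · have hle : Submodule.span ℝ (jointReach τ S₁ S₂) ≤
        (Submodule.span ℝ (jointReach τ S₁ S₂)).comap
          ((Matrix.mulVecLin (S₁.A q)).prodMap (Matrix.mulVecLin (S₂.A q))) :=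
      Submodule.span_le.2 fun w hw => by simpa using hstep hw q 0
    exact hle hw
  · have hle : Submodule.span ℝ (jointReach τ S₁ S₂) ≤ LinearMap.eqLocus
        (Matrix.mulVecLin (S₁.C q) ∘ₗ LinearMap.fst ℝ _ _)
        (Matrix.mulVecLin (S₂.C q) ∘ₗ LinearMap.snd ℝ _ _) :=
      Submodule.span_le.2 fun w hw => h.output_eq hw q
    exact hle hw

end Joint

end LSS

namespace LSS

variable {D m p n : ℕ}

/-! ### Minimal systems -/

section Minimal

variable {V : Type*} [AddCommGroup V] [Module ℝ V] [FiniteDimensional ℝ V]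

/-- The system given by linear maps on a finite-dimensional state space, in the coordinates of a
basis. -/
noncomputable def ofLinearMaps (a : Fin D → V →ₗ[ℝ] V) (b : Fin D → (Fin m → ℝ) →ₗ[ℝ] V)
    (c : Fin D → V →ₗ[ℝ] (Fin p → ℝ)) : LSS D m p (Module.finrank ℝ V) where
  A q := LinearMap.toMatrix' ((Module.finBasis ℝ V).equivFun.toLinearMap ∘ₗ a q ∘ₗ
    (Module.finBasis ℝ V).equivFun.symm.toLinearMap)
  B q := LinearMap.toMatrix' ((Module.finBasis ℝ V).equivFun.toLinearMap ∘ₗ b q)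
  C q := LinearMap.toMatrix' (c q ∘ₗ (Module.finBasis ℝ V).equivFun.symm.toLinearMap)

variable {τ : TimeDomain} {S : LSS D m p n} {a : Fin D → V →ₗ[ℝ] V}
  {b : Fin D → (Fin m → ℝ) →ₗ[ℝ] V} {c : Fin D → V →ₗ[ℝ] (Fin p → ℝ)}

/-- Turns minimality into a bound for coordinate-free systems, such as restrictions to subspaces. -/
theorem IsMinimal.le_finrank_of_hom_to (hS : S.IsMinimal τ) (f : V →ₗ[ℝ] (Fin n → ℝ))
    (hA : ∀ q x, f (a q x) = (S.A q).mulVec (f x)) (hB : ∀ q v, f (b q v) = (S.B q).mulVec v)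
    (hC : ∀ q x, c q x = (S.C q).mulVec (f x)) : n ≤ Module.finrank ℝ V := by
  have hf : (ofLinearMaps a b c).IsHom S (f ∘ₗ (Module.finBasis ℝ V).equivFun.symm.toLinearMap) := by
    constructor <;> intros <;>
      simp only [ofLinearMaps, LinearMap.toMatrix'_mulVec, LinearMap.comp_apply,
        LinearEquiv.coe_coe, LinearEquiv.symm_apply_apply, hA, hB, hC]
  exact hS _ _ (hf.equivalent τ)

theorem IsMinimal.le_finrank_of_hom_from (hS : S.IsMinimal τ) (f : (Fin n → ℝ) →ₗ[ℝ] V)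
    (hA : ∀ q x, f ((S.A q).mulVec x) = a q (f x)) (hB : ∀ q v, f ((S.B q).mulVec v) = b q v)
    (hC : ∀ q x, (S.C q).mulVec x = c q (f x)) : n ≤ Module.finrank ℝ V := by
  have hf : S.IsHom (ofLinearMaps a b c) ((Module.finBasis ℝ V).equivFun.toLinearMap ∘ₗ f) := by
    constructor <;> intros <;>
      simp only [ofLinearMaps, LinearMap.toMatrix'_mulVec, LinearMap.comp_apply,
        LinearEquiv.coe_coe, LinearEquiv.symm_apply_apply, hA, hB, hC]
  exact hS _ _ (hf.equivalent τ).symm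

end Minimal

/-- Minimal systems are span-reachable. -/
theorem IsMinimal.eq_top_of_invariant {τ : TimeDomain} {S : LSS D m p n} (hS : S.IsMinimal τ)
    {R : Submodule ℝ (Fin n → ℝ)} (hA : ∀ q, ∀ x ∈ R, (S.A q).mulVec x ∈ R)
    (hB : ∀ q v, (S.B q).mulVec v ∈ R) : R = ⊤ := by
  have h := hS.le_finrank_of_hom_to (V := R)
    (a := fun q => (Matrix.mulVecLin (S.A q)).restrict (hA q))
    (b := fun q => (Matrix.mulVecLin (S.B q)).codRestrict R (hB q))
    (c := fun q => Matrix.mulVecLin (S.C q) ∘ₗ R.subtype) R.subtype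
    (fun _ _ => rfl) (fun _ _ => rfl) (fun _ _ => rfl)
  refine Submodule.eq_top_of_finrank_eq (le_antisymm (Submodule.finrank_le R) ?_)
  simpa using h

/-- Minimal systems are observable. -/
theorem IsMinimal.eq_bot_of_invariant {τ : TimeDomain} {S : LSS D m p n} (hS : S.IsMinimal τ)
    {U : Submodule ℝ (Fin n → ℝ)} (hA : ∀ q, ∀ x ∈ U, (S.A q).mulVec x ∈ U)
    (hC : ∀ q, ∀ x ∈ U, (S.C q).mulVec x = 0) : U = ⊥ := by
  have h := hS.le_finrank_of_hom_from (V := (Fin n → ℝ) ⧸ U)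
    (a := fun q => U.mapQ U (Matrix.mulVecLin (S.A q)) (hA q))
    (b := fun q => U.mkQ ∘ₗ Matrix.mulVecLin (S.B q))
    (c := fun q => U.liftQ (Matrix.mulVecLin (S.C q)) (hC q)) U.mkQ
    (fun _ _ => rfl) (fun _ _ => rfl) (fun _ _ => rfl)
  have h2 := U.finrank_quotient_add_finrank
  rw [Module.finrank_fin_fun] at h2
  exact Submodule.finrank_eq_zero.1 (by omega)

/-- Equivalent minimal systems are isomorphic. -/
theorem Equivalent.exists_linearEquiv {n₁ n₂ : ℕ} (hD : 0 < D) {τ : TimeDomain}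
    {S₁ : LSS D m p n₁} {S₂ : LSS D m p n₂} (hS₁ : S₁.IsMinimal τ) (hS₂ : S₂.IsMinimal τ)
    (h : Equivalent τ S₁ S₂) :
    ∃ T : (Fin n₁ → ℝ) ≃ₗ[ℝ] (Fin n₂ → ℝ), S₁.IsHom S₂ T.toLinearMap := by
  obtain ⟨V, hB, hA, hC⟩ := h.exists_invariant_submodule hD
  let p₁ : V →ₗ[ℝ] (Fin n₁ → ℝ) := LinearMap.fst ℝ _ _ ∘ₗ V.subtype
  let p₂ : V →ₗ[ℝ] (Fin n₂ → ℝ) := LinearMap.snd ℝ _ _ ∘ₗ V.subtype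
  have hp₁ : LinearMap.range p₁ = ⊤ := hS₁.eq_top_of_invariant
    (by rintro q _ ⟨w, rfl⟩; exact ⟨⟨_, hA q w w.2⟩, rfl⟩) (fun q v => ⟨⟨_, hB q v⟩, rfl⟩)
  have hp₂ : LinearMap.range p₂ = ⊤ := hS₂.eq_top_of_invariant
    (by rintro q _ ⟨w, rfl⟩; exact ⟨⟨_, hA q w w.2⟩, rfl⟩) (fun q v => ⟨⟨_, hB q v⟩, rfl⟩)
  -- The fibre of `V` over `0` is invariant, and on it the output equals that of the zero state;
  -- being unobservable, it vanishes. This fibre is the kernel of the projection `p₁`.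
  have hU₂ : V.comap (LinearMap.inr ℝ _ _) = ⊥ := hS₂.eq_bot_of_invariant
    (fun q x hx => by simpa using hA q _ hx) (fun q x hx => by simpa using (hC q _ hx).symm)
  have hU₁ : V.comap (LinearMap.inl ℝ _ _) = ⊥ := hS₁.eq_bot_of_invariant
    (fun q x hx => by simpa using hA q _ hx) (fun q x hx => by simpa using hC q _ hx)
  have hk₁ : LinearMap.ker p₁ = ⊥ := by
    refine (Submodule.eq_bot_iff _).2 fun w hw => ?_
    have hw1 : w.1.1 = 0 := hw
    have hmem : w.1.2 ∈ V.comap (LinearMap.inr ℝ (Fin n₁ → ℝ) (Fin n₂ → ℝ)) := by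
      change (0, w.1.2) ∈ V
      rw [← hw1]
      exact w.2
    rw [hU₂] at hmem
    exact Subtype.ext (Prod.ext hw1 hmem)
  have hk₂ : LinearMap.ker p₂ = ⊥ := by
    refine (Submodule.eq_bot_iff _).2 fun w hw => ?_
    have hw2 : w.1.2 = 0 := hw
    have hmem : w.1.1 ∈ V.comap (LinearMap.inl ℝ (Fin n₁ → ℝ) (Fin n₂ → ℝ)) := by
      change (w.1.1, 0) ∈ V
      rw [← hw2]
      exact w.2
    rw [hU₁] at hmem
    exact Subtype.ext (Prod.ext hmem hw2)
  let e₁ : V ≃ₗ[ℝ] (Fin n₁ → ℝ) :=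
    LinearEquiv.ofBijective p₁ ⟨LinearMap.ker_eq_bot.1 hk₁, LinearMap.range_eq_top.1 hp₁⟩
  let e₂ : V ≃ₗ[ℝ] (Fin n₂ → ℝ) :=
    LinearEquiv.ofBijective p₂ ⟨LinearMap.ker_eq_bot.1 hk₂, LinearMap.range_eq_top.1 hp₂⟩
  have key (w : V) : (e₁.symm.trans e₂) w.1.1 = w.1.2 := by
    have h1 : e₁ w = w.1.1 := rfl
    rw [LinearEquiv.trans_apply, ← h1, e₁.symm_apply_apply]
    rfl
  refine ⟨e₁.symm.trans e₂, fun q x => ?_, fun q v => key ⟨_, hB q v⟩, fun q x => ?_⟩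
  all_goals
    obtain ⟨w, rfl⟩ := e₁.surjective x
    have h1 : e₁ w = w.1.1 := rfl
  · have h2 := key ⟨_, hA q w w.2⟩
    have h3 := key w
    simp only [LinearEquiv.coe_coe, h1, h3]
    exact h2
  · have h3 := key w
    simp only [LinearEquiv.coe_coe, h1, h3]
    exact hC q w w.2

/-! ### Transport of grammians -/

section Transport

open Matrix

variable {S S' : LSS D m p n} {T U : Matrix (Fin n) (Fin n) ℝ}

/-- In either time domain the left-hand side of the inequality transforms by the congruence `X ↦ T X
Tᵀ`, which preserves semidefiniteness, and definiteness as `T` is invertible. -/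
theorem isControllabilityGrammian_conj {τ : TimeDomain} (hUT : U * T = 1) (hTU : T * U = 1)
    (hA : ∀ q, T * S.A q = S'.A q * T) (hB : ∀ q, T * S.B q = S'.B q)
    {P : Matrix (Fin n) (Fin n) ℝ} (hP : S.IsControllabilityGrammian τ P) :
    S'.IsControllabilityGrammian τ (T * P * Tᵀ) := by
  have hA' (q : Fin D) : S'.A q = T * S.A q * U := by
    rw [hA, Matrix.mul_assoc, hTU, Matrix.mul_one]
  have hUT' : Tᵀ * Uᵀ = 1 := by rw [← transpose_mul, hUT, transpose_one]
  have hL (q : Fin D) : S'.ctrLMI τ q (T * P * Tᵀ) = T * S.ctrLMI τ q P * Tᵀ := by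
    have h1 (X : Matrix (Fin n) (Fin n) ℝ) : U * (T * X) = X := by
      rw [← Matrix.mul_assoc, hUT, Matrix.one_mul]
    have h2 (X : Matrix (Fin n) (Fin n) ℝ) : Tᵀ * (Uᵀ * X) = X := by
      rw [← Matrix.mul_assoc, hUT', Matrix.one_mul]
    cases τ <;>
      simp only [ctrLMI, hA', ← hB, transpose_mul, Matrix.mul_add, Matrix.add_mul, Matrix.mul_sub,
        Matrix.sub_mul, Matrix.mul_assoc, h1, h2]
  refine ⟨?_, fun q => ?_⟩
  · have hinj : Function.Injective Tᵀ.mulVec := fun x y hxy => by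
      have := congrArg Uᵀ.mulVec hxy
      rwa [mulVec_mulVec, mulVec_mulVec, ← transpose_mul, hTU, transpose_one, one_mulVec,
        one_mulVec] at this
    simpa using hP.1.conjTranspose_mul_mul_same (B := Tᵀ) hinj
  · have := (hP.2 q).mul_mul_conjTranspose_same T
    rw [hL]
    simpa using this

/-- The dual system. -/
def dual (S : LSS D m p n) : LSS D p m n where
  A q := (S.A q)ᵀ
  B q := (S.C q)ᵀ
  C q := (S.B q)ᵀ

theorem isObservabilityGrammian_iff_dual {τ : TimeDomain} {Q : Matrix (Fin n) (Fin n) ℝ} :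
    S.IsObservabilityGrammian τ Q ↔ S.dual.IsControllabilityGrammian τ Q := by
  cases τ <;> simp [IsObservabilityGrammian, IsControllabilityGrammian, obsLMI, ctrLMI, dual]

/-- Duality reduces this to the controllability case, with `Uᵀ` as the change of coordinates. -/
theorem isObservabilityGrammian_conj {τ : TimeDomain} (hUT : U * T = 1) (hTU : T * U = 1)
    (hA : ∀ q, T * S.A q = S'.A q * T) (hC : ∀ q, S.C q = S'.C q * T)
    {Q : Matrix (Fin n) (Fin n) ℝ} (hQ : S.IsObservabilityGrammian τ Q) :
    S'.IsObservabilityGrammian τ (Uᵀ * Q * U) := by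
  rw [isObservabilityGrammian_iff_dual] at hQ ⊢
  have h := isControllabilityGrammian_conj (S' := S'.dual) (T := Uᵀ) (U := Tᵀ)
    (by rw [← transpose_mul, hUT, transpose_one]) (by rw [← transpose_mul, hTU, transpose_one])
    (fun q => ?_) (fun q => ?_) hQ
  · simpa using h
  · simp only [dual, ← transpose_mul]
    congr 1
    calc S.A q * U = U * (T * S.A q) * U := by
          rw [← Matrix.mul_assoc, hUT, Matrix.one_mul]
      _ = U * S'.A q := by
          rw [hA, Matrix.mul_assoc, Matrix.mul_assoc, hTU, Matrix.mul_one]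
  · simp only [dual, ← transpose_mul]
    rw [hC, Matrix.mul_assoc, hTU, Matrix.mul_one]

theorem grammianSingularValues_conj (hUT : U * T = 1) (P Q : Matrix (Fin n) (Fin n) ℝ) :
    grammianSingularValues (T * P * Tᵀ) (Uᵀ * Q * U) = grammianSingularValues P Q := by
  have hUT' : Tᵀ * Uᵀ = 1 := by rw [← transpose_mul, hUT, transpose_one]
  have h : T * P * Tᵀ * (Uᵀ * Q * U) = T * (P * Q * U) := by
    calc _ = T * P * (Tᵀ * Uᵀ) * Q * U := by simp only [Matrix.mul_assoc]
      _ = _ := by rw [hUT', Matrix.mul_one]; simp only [Matrix.mul_assoc]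
  rw [grammianSingularValues, grammianSingularValues, h, Matrix.charpoly_mul_comm,
    Matrix.mul_assoc, hUT, Matrix.mul_one]

end Transport

theorem Equivalent.exists_isGrammianPair {n₁ n₂ : ℕ} (hD : 0 < D) {τ : TimeDomain}
    {S₁ : LSS D m p n₁} {S₂ : LSS D m p n₂} (hS₁ : S₁.IsMinimal τ) (hS₂ : S₂.IsMinimal τ)
    (h : Equivalent τ S₁ S₂) {P₁ Q₁ : Matrix (Fin n₁) (Fin n₁) ℝ}
    (hPQ : S₁.IsGrammianPair τ P₁ Q₁) :
    ∃ P₂ Q₂ : Matrix (Fin n₂) (Fin n₂) ℝ, S₂.IsGrammianPair τ P₂ Q₂ ∧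
      grammianSingularValues P₂ Q₂ = grammianSingularValues P₁ Q₁ := by
  -- Each system realizes the other's input-output map, so minimality bounds each dimension by the
  -- other.
  obtain rfl : n₁ = n₂ := le_antisymm (hS₁ _ _ h.symm) (hS₂ _ _ h)
  obtain ⟨e, he⟩ := h.exists_linearEquiv hD hS₁ hS₂
  let T := LinearMap.toMatrix' e.toLinearMap
  let U := LinearMap.toMatrix' e.symm.toLinearMap
  have hUT : U * T = 1 := by rw [← LinearMap.toMatrix'_comp]; simp
  have hTU : T * U = 1 := by rw [← LinearMap.toMatrix'_comp]; simp
  have hT (x : Fin n₁ → ℝ) : T.mulVec x = e x := LinearMap.toMatrix'_mulVec _ _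
  have hA (q : Fin D) : T * S₁.A q = S₂.A q * T := by
    refine Matrix.ext_of_mulVec_single fun i => ?_
    rw [← Matrix.mulVec_mulVec, ← Matrix.mulVec_mulVec, hT, hT]
    exact he.map_A q _
  have hB (q : Fin D) : T * S₁.B q = S₂.B q := by
    refine Matrix.ext_of_mulVec_single fun i => ?_
    rw [← Matrix.mulVec_mulVec, hT]
    exact he.map_B q _
  have hC (q : Fin D) : S₁.C q = S₂.C q * T := by
    refine Matrix.ext_of_mulVec_single fun i => ?_
    rw [← Matrix.mulVec_mulVec, hT]
    exact he.map_C q _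
  exact ⟨_, _, ⟨isControllabilityGrammian_conj hUT hTU hA hB hPQ.1,
    isObservabilityGrammian_conj hUT hTU hA hC hPQ.2⟩, grammianSingularValues_conj hUT P₁ Q₁⟩

end LSS

theorem mainTheorem3 (τ : TimeDomain) {D m p n₁ n₂ : ℕ} (hD : 0 < D)
    (S₁ : LSS D m p n₁) (S₂ : LSS D m p n₂)
    (hS₁ : S₁.IsMinimal τ) (hS₂ : S₂.IsMinimal τ) (hequiv : LSS.Equivalent τ S₁ S₂) :
    (∀ P₁ Q₁ : Matrix (Fin n₁) (Fin n₁) ℝ, S₁.IsGrammianPair τ P₁ Q₁ →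
      ∃ P₂ Q₂ : Matrix (Fin n₂) (Fin n₂) ℝ, S₂.IsGrammianPair τ P₂ Q₂ ∧
        grammianSingularValues P₂ Q₂ = grammianSingularValues P₁ Q₁) ∧
    {s : Multiset ℝ | ∃ P Q : Matrix (Fin n₁) (Fin n₁) ℝ,
        S₁.IsGrammianPair τ P Q ∧ grammianSingularValues P Q = s} =
      {s : Multiset ℝ | ∃ P Q : Matrix (Fin n₂) (Fin n₂) ℝ,
        S₂.IsGrammianPair τ P Q ∧ grammianSingularValues P Q = s} := by
  have h₁₂ := fun P₁ Q₁ => hequiv.exists_isGrammianPair hD hS₁ hS₂ (P₁ := P₁) (Q₁ := Q₁)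
  refine ⟨h₁₂, Subset.antisymm ?_ ?_⟩
  · rintro s ⟨P, Q, hPQ, rfl⟩
    exact h₁₂ P Q hPQ
  · rintro s ⟨P, Q, hPQ, rfl⟩
    exact hequiv.symm.exists_isGrammianPair hD hS₂ hS₁ hPQ
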